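/- Let $K$ be a field and let $l,m,n$ be positive integers with $2\le m\le n$, $l\mid n$ and $l\le\min\{m-1,n/2\}$. Let $0\le s<l$ with $m\equiv s \pmod l$, put $t=(m-s)/l$ and $k=n/l$, and assume $t\ge 2$. Let $V=\{x_1,\dots,x_n\}$ be the vertex set of the cycle $C_n$, with indices read modulo $n$, and for $1\le i\le k$ let $F_i=\{x_{(i-1)l+1},x_{(i-1)l+2},\dots,x_{(i-1)l+m}\}$. Let $\Delta_{m,l}(C_n)=\langle F_1,\dots,F_k\rangle$ be the simplicial complex on $V$ generated by the $F_i$ (the path complex of $C_n$), and let $(\Delta_{m,l}(C_n))^c_V$ be the simplicial complex generated by the complements $V\setminus F$ of the facets $F$ of $\Delta_{m,l}(C_n)$, that is, $\langle V\setminus F_1,\dots,V\setminus F_k\rangle$ (the empty set is a face). Write $k=p(t+1)+d$ with integers $p\ge 0$ and $0\le d\le t$. Then for every integer $i$, the reduced simplicial homology with coefficients in $K$ is $$\widetilde H_i\big((\Delta_{m,l}(C_n))^c_V\big)\cong\begin{cases}K^t,&\text{if } d=0,\ i=2p-2 \text{ and } p>0;\\ K,&\text{if } d\ne 0 \text{ and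 } i=2p-1;\\ 0,&\text{otherwise.}\end{cases}$$ -/

import Mathlib

set_option maxSynthPendingDepth 3

/-! Simplicial complexes on a vertex type `V` are downward closed collections of finite subsets of
`V`, i.e. terms of `LowerSet (Finset V)`; the empty set is allowed as a face, so that the complex
`{∅}` differs from the void complex. The complex `⟨F₁, …, F_q⟩` generated by some finite sets is
their `lowerClosure`. -/

namespace SimplicialHomology

section Complexes

variable {V : Type*}

/-- The facets of a simplicial complex: its maximal faces under inclusion. -/
def facets (Δ : LowerSet (Finset V)) : Set (Finset V) :=
  {F | Maximal (· ∈ Δ) F}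

/-- The complement complex `Δ_V^c`, generated by the complements `V \ F` of the facets `F` of `Δ`. -/
def complementComplex [Fintype V] [DecidableEq V] (Δ : LowerSet (Finset V)) :
    LowerSet (Finset V) :=
  lowerClosure ((fun F : Finset V => Fᶜ) '' facets Δ)

end Complexes

section Homology

variable (K : Type*) [Field K] {V : Type*} [LinearOrder V]

/-- The sign `(-1)^a` with which the face `F \ {x}` occurs in the boundary of `F`, where `x` is
preceded by exactly `a` elements of `F`. -/
def faceSign (F : Finset V) (x : V) : K :=
  (-1) ^ (F.filter (· < x)).card

/-- The augmented simplicial boundary map, on the vector space with basis all finite subsets of `V`: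
`∂ {v₀ < ⋯ < v_i} = ∑ₐ (-1)^a {v₀, …, v_i} \ {v_a}`. In particular `∂ {v} = ∅` and `∂ ∅ = 0`. -/
noncomputable def boundary : (Finset V →₀ K) →ₗ[K] (Finset V →₀ K) :=
  Finsupp.linearCombination K fun F : Finset V =>
    ∑ x ∈ F, Finsupp.single (F.erase x) (faceSign K F x)

variable (Δ : LowerSet (Finset V)) (i : ℤ)

/-- The reduced `i`-chains of `Δ`: the span of the `i`-dimensional faces, i.e. those with `i + 1`
elements. For `i = -1` the only possible face is `∅`. -/
def chains : Submodule K (Finset V →₀ K) :=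
  Finsupp.supported K K {F | F ∈ Δ ∧ (F.card : ℤ) = i + 1}

/-- The reduced `i`-cycles `Z_i(Δ)`. -/
noncomputable def cycles : Submodule K (Finset V →₀ K) :=
  chains K Δ i ⊓ LinearMap.ker (boundary K)

/-- The reduced `i`-boundaries `B_i(Δ)`. -/
noncomputable def boundaries : Submodule K (Finset V →₀ K) :=
  (chains K Δ (i + 1)).map (boundary K)

/-- The reduced homology `H̃_i(Δ) = Z_i(Δ) / B_i(Δ)` with coefficients in `K`, for `i : ℤ`. -/
abbrev ReducedHomology : Type _ :=
  cycles K Δ i ⧸ (boundaries K Δ i).submoduleOf (cycles K Δ i)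

lemma boundary_single (F : Finset V) :
    boundary K (Finsupp.single F 1) =
      ∑ x ∈ F, Finsupp.single (F.erase x) (faceSign K F x) := by
  simp [boundary]

lemma faceSign_erase_of_lt {F : Finset V} {x y : V} (hx : x ∈ F) (h : x < y) :
    faceSign K (F.erase x) y = - faceSign K F y := by
  have hmem : x ∈ F.filter (· < y) := by simp [hx, h]
  have hcard := Finset.card_erase_add_one hmem
  unfold faceSign
  rw [Finset.filter_erase, ← hcard, pow_succ]
  simp

lemma faceSign_erase_of_gt {F : Finset V} {x y : V} (h : y < x) :
    faceSign K (F.erase x) y = faceSign K F y := by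
  unfold faceSign
  rw [Finset.filter_erase, Finset.erase_eq_of_notMem]
  simp [h.le]

lemma boundary_boundary (c : Finset V →₀ K) : boundary K (boundary K c) = 0 := by
  suffices h : (boundary K).comp (boundary K) = (0 : (Finset V →₀ K) →ₗ[K] (Finset V →₀ K)) from
    LinearMap.congr_fun h c
  refine Finsupp.lhom_ext' fun F => LinearMap.ext_ring ?_
  have hs : ∀ (G : Finset V) (a : K), boundary K (Finsupp.single G a) =
      ∑ y ∈ G, Finsupp.single (G.erase y) (a * faceSign K G y) := by
    intro G a
    simp [boundary, Finset.smul_sum]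
  simp only [LinearMap.comp_apply, Finsupp.lsingle_apply, LinearMap.zero_apply]
  rw [boundary_single, map_sum]
  simp only [hs]
  rw [Finset.sum_sigma']
  refine Finset.sum_involution (fun q _ => ⟨q.2, q.1⟩) ?_ ?_ ?_ ?_
  · rintro ⟨x, y⟩ hq
    simp only [Finset.mem_sigma, Finset.mem_erase] at hq
    obtain ⟨hx, hyx, hy⟩ := hq
    dsimp only
    rw [Finset.erase_right_comm (a := y) (b := x), ← Finsupp.single_add]
    rcases lt_or_gt_of_ne hyx with h | h
    · rw [faceSign_erase_of_gt K h, faceSign_erase_of_lt K hy h]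
      simp [mul_comm]
    · rw [faceSign_erase_of_gt K h, faceSign_erase_of_lt K hx h]
      simp [mul_comm]
  · rintro ⟨x, y⟩ hq _ heq
    simp only [Finset.mem_sigma, Finset.mem_erase] at hq
    simp only [Sigma.mk.injEq] at heq
    exact hq.2.1 heq.1
  · rintro ⟨x, y⟩ hq
    simp only [Finset.mem_sigma, Finset.mem_erase] at hq ⊢
    exact ⟨hq.2.2, hq.2.1.symm, hq.1⟩
  · rintro ⟨x, y⟩ _
    rfl

lemma boundary_mem_chains {c : Finset V →₀ K} (hc : c ∈ chains K Δ (i + 1)) :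
    boundary K c ∈ chains K Δ i := by
  rw [boundary, Finsupp.linearCombination_apply]
  refine Submodule.sum_mem _ fun F hF => Submodule.smul_mem _ _ (Submodule.sum_mem _ fun x hx => ?_)
  obtain ⟨hFΔ, hcard⟩ := (Finsupp.mem_supported K c).1 hc hF
  refine Finsupp.single_mem_supported K _ ⟨Δ.lower (Finset.erase_subset x F) hFΔ, ?_⟩
  have := Finset.card_erase_add_one hx
  push_cast [← this] at hcard
  linarith

/-- Boundaries are cycles. -/
lemma boundaries_le_cycles : boundaries K Δ i ≤ cycles K Δ i := by
  rintro _ ⟨c, hc, rfl⟩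
  exact ⟨boundary_mem_chains K Δ i hc, boundary_boundary K c⟩

end Homology

end SimplicialHomology

namespace CyclePaths

/-- The path `{x_{il+1}, …, x_{il+m}}` of the cycle `C_n`, with indices read modulo `n`. The vertices
`x_1, …, x_n` of `C_n` are the elements `0, …, n - 1` of `Fin n`. -/
def path (n m l i : ℕ) : Finset (Fin n) :=
  Finset.univ.filter fun v => ∃ j < m, (v : ℕ) = (i * l + j) % n

/-- The path complex `Δ_{m,l}(C_n) = ⟨F_1, …, F_k⟩` with its standard labelling, where
`k = n / gcd (l, n)` and `F_{i+1} = path n m l i`. -/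
def pathComplex (n m l : ℕ) : LowerSet (Finset (Fin n)) :=
  lowerClosure {F | ∃ i < n / Nat.gcd l n, F = path n m l i}

end CyclePaths

/-! The complement complex consists of the vertex sets that avoid some path. A path containing the
last vertex of a block `{jl, …, jl + l - 1}` contains the whole block, so only the block ends matter
up to homology: these are `k` positions on a cycle, on which the paths are the cyclic segments of
length `t = ⌊m / l⌋`.

Without the last `t` positions the complex is a simplex. When these are restored one by one, the
links are complexes of sets avoiding a segment of length `t`, or an initial segment of some length
`c ≤ t`, of an interval. Removing that initial segment from an interval of length `u` replaces
`(u, c)` by `(u - c, t + 1 - c)` and desuspends the complex, so doing it twice shortens the interval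
by `t + 1`. Hence each link is a homology sphere or acyclic: all `t` links are spheres of the same
dimension if `t + 1` divides `k`, and otherwise exactly one of them is a sphere. -/

namespace SimplicialHomology

section Operators

variable (K : Type*) [Field K] {V : Type*} [LinearOrder V]

/-- Contraction by the vertex `v`: the term `± F \ {v}` of the boundary of a face `F` containing
`v`, and `0` on a face not containing `v`. The boundary map is the sum of all contractions. -/
noncomputable def contract (v : V) : (Finset V →₀ K) →ₗ[K] (Finset V →₀ K) :=
  Finsupp.linearCombination K fun F : Finset V =>
    if v ∈ F then Finsupp.single (F.erase v) (faceSign K F v) else 0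

/-- The cone operator with apex `v`: it sends a face `F` not containing `v` to `± F ∪ {v}`, and a
face containing `v` to `0`. The sign makes it a contracting homotopy of every cone with apex `v`. -/
noncomputable def cone (v : V) : (Finset V →₀ K) →ₗ[K] (Finset V →₀ K) :=
  Finsupp.linearCombination K fun F : Finset V =>
    if v ∈ F then 0 else Finsupp.single (insert v F) (faceSign K F v)

lemma contract_single (v : V) (F : Finset V) (a : K) :
    contract K v (Finsupp.single F a) =
      if v ∈ F then Finsupp.single (F.erase v) (a * faceSign K F v) else 0 := by
  simp [contract]

lemma cone_single (v : V) (F : Finset V) (a : K) :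
    cone K v (Finsupp.single F a) =
      if v ∈ F then 0 else Finsupp.single (insert v F) (a * faceSign K F v) := by
  simp [cone]

lemma faceSign_mul_self (F : Finset V) (x : V) : faceSign K F x * faceSign K F x = 1 := by
  simp [faceSign, ← mul_pow]

lemma faceSign_erase_self (F : Finset V) (x : V) :
    faceSign K (F.erase x) x = faceSign K F x := by
  unfold faceSign
  rw [Finset.filter_erase, Finset.erase_eq_of_notMem]
  simp

lemma faceSign_insert_self (F : Finset V) (x : V) :
    faceSign K (insert x F) x = faceSign K F x := by
  unfold faceSign
  rw [Finset.filter_insert, if_neg (lt_irrefl x)]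

lemma faceSign_insert_of_lt {F : Finset V} {x y : V} (hx : x ∉ F) (h : x < y) :
    faceSign K (insert x F) y = - faceSign K F y := by
  have := faceSign_erase_of_lt K (Finset.mem_insert_self x F) h
  rw [Finset.erase_insert hx] at this
  rw [this, neg_neg]

lemma faceSign_insert_of_gt {F : Finset V} {x y : V} (h : y < x) :
    faceSign K (insert x F) y = faceSign K F y := by
  unfold faceSign
  rw [Finset.filter_insert, if_neg h.not_gt]

lemma contract_contract_self (v : V) (c : Finset V →₀ K) : contract K v (contract K v c) = 0 := by
  refine LinearMap.congr_fun (f := contract K v ∘ₗ contract K v) (g := 0)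
    (Finsupp.lhom_ext fun F a => ?_) c
  by_cases hv : v ∈ F <;> simp [contract_single, hv, -Finsupp.single_mul]

lemma contract_contract_add (x y : V) (c : Finset V →₀ K) :
    contract K x (contract K y c) + contract K y (contract K x c) = 0 := by
  rcases eq_or_ne x y with rfl | hxy
  · rw [contract_contract_self, add_zero]
  refine LinearMap.congr_fun
    (f := contract K x ∘ₗ contract K y + contract K y ∘ₗ contract K x) (g := 0)
    (Finsupp.lhom_ext fun F a => ?_) c
  simp only [LinearMap.add_apply, LinearMap.comp_apply, LinearMap.zero_apply]
  by_cases hx : x ∈ F <;> by_cases hy : y ∈ F <;>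
    simp only [contract_single, hx, hy, if_true, if_false, map_zero, Finset.mem_erase, ne_eq,
      hxy, hxy.symm, not_false_eq_true, and_true, and_false, add_zero]
  rw [Finset.erase_right_comm, ← Finsupp.single_add]
  rcases lt_or_gt_of_ne hxy with h | h
  · rw [faceSign_erase_of_gt K h, faceSign_erase_of_lt K hx h]
    simp [mul_right_comm]
  · rw [faceSign_erase_of_gt K h, faceSign_erase_of_lt K hy h]
    simp [mul_right_comm]

lemma contract_cone_add_of_ne {x v : V} (hxv : x ≠ v) (c : Finset V →₀ K) :
    contract K x (cone K v c) + cone K v (contract K x c) = 0 := by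
  refine LinearMap.congr_fun (f := contract K x ∘ₗ cone K v + cone K v ∘ₗ contract K x) (g := 0)
    (Finsupp.lhom_ext fun F a => ?_) c
  simp only [LinearMap.add_apply, LinearMap.comp_apply, LinearMap.zero_apply]
  by_cases hx : x ∈ F <;> by_cases hv : v ∈ F <;>
    simp only [contract_single, cone_single, hx, hv, if_true, if_false, map_zero,
      Finset.mem_erase, Finset.mem_insert, ne_eq, hxv, hxv.symm, not_false_eq_true, and_true,
      and_false, add_zero, or_true, or_false]
  rw [Finset.erase_insert_of_ne hxv.symm, ← Finsupp.single_add]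
  rcases lt_or_gt_of_ne hxv with h | h
  · rw [faceSign_insert_of_gt K h, faceSign_erase_of_lt K hx h]
    simp [mul_right_comm]
  · rw [faceSign_insert_of_lt K hv h, faceSign_erase_of_gt K h]
    simp [mul_right_comm]

lemma contract_cone_add_self (v : V) (c : Finset V →₀ K) :
    contract K v (cone K v c) + cone K v (contract K v c) = c := by
  refine LinearMap.congr_fun (f := contract K v ∘ₗ cone K v + cone K v ∘ₗ contract K v)
    (g := LinearMap.id) (Finsupp.lhom_ext fun F a => ?_) c
  by_cases hv : v ∈ F <;>
    simp [contract_single, cone_single, hv, faceSign_erase_self, faceSign_insert_self, mul_assoc,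
      faceSign_mul_self, -Finsupp.single_mul]

lemma boundary_single_eq_sum_contract {F U : Finset V} (h : F ⊆ U) (a : K) :
    boundary K (Finsupp.single F a) = ∑ x ∈ U, contract K x (Finsupp.single F a) := by
  simp [boundary, contract_single, Finset.smul_sum, Finset.sum_ite_mem, Finset.inter_eq_right.2 h]

lemma boundary_contract (v : V) (c : Finset V →₀ K) :
    boundary K (contract K v c) = - contract K v (boundary K c) := by
  refine LinearMap.congr_fun (f := boundary K ∘ₗ contract K v) (g := -(contract K v ∘ₗ boundary K))
    (Finsupp.lhom_ext fun F a => ?_) c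
  have hsum : boundary K (contract K v (Finsupp.single F a)) =
      ∑ x ∈ F, contract K x (contract K v (Finsupp.single F a)) := by
    rw [contract_single]
    split_ifs
    · exact boundary_single_eq_sum_contract K (Finset.erase_subset v F) _
    · simp
  simp only [LinearMap.comp_apply, LinearMap.neg_apply]
  rw [hsum, boundary_single_eq_sum_contract K subset_rfl, map_sum, eq_neg_iff_add_eq_zero,
    ← Finset.sum_add_distrib]
  exact Finset.sum_eq_zero fun x _ => contract_contract_add K x v _

lemma boundary_cone (v : V) (c : Finset V →₀ K) :
    boundary K (cone K v c) = c - cone K v (boundary K c) := by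
  refine LinearMap.congr_fun (f := boundary K ∘ₗ cone K v)
    (g := LinearMap.id - cone K v ∘ₗ boundary K) (Finsupp.lhom_ext fun F a => ?_) c
  have hsum : boundary K (cone K v (Finsupp.single F a)) =
      ∑ x ∈ insert v F, contract K x (cone K v (Finsupp.single F a)) := by
    rw [cone_single]
    split_ifs
    · simp
    · exact boundary_single_eq_sum_contract K subset_rfl _
  simp only [LinearMap.comp_apply, LinearMap.sub_apply, LinearMap.id_apply]
  rw [hsum, boundary_single_eq_sum_contract K (Finset.subset_insert v F), map_sum,
    eq_sub_iff_add_eq, ← Finset.sum_add_distrib, Finset.sum_eq_single v]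
  · exact contract_cone_add_self K v _
  · exact fun x _ hx => contract_cone_add_of_ne K hx _
  · exact fun hv => absurd (Finset.mem_insert_self v F) hv

variable {K} in
lemma contract_cone_of_contract_eq_zero {v : V} {c : Finset V →₀ K} (h : contract K v c = 0) :
    contract K v (cone K v c) = c := by
  simpa [h] using contract_cone_add_self K v c

end Operators

section DeletionLink

variable {V : Type*}

/-- The deletion of the vertex `v`: all faces not containing `v`. -/
def deletion (Δ : LowerSet (Finset V)) (v : V) : LowerSet (Finset V) where
  carrier := {F | v ∉ F ∧ F ∈ Δ}
  lower' _ _ hGF hF := ⟨fun h => hF.1 (hGF h), Δ.lower hGF hF.2⟩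

/-- The link of the vertex `v`: all faces not containing `v` whose union with `{v}` is a face. -/
def link [DecidableEq V] (Δ : LowerSet (Finset V)) (v : V) : LowerSet (Finset V) where
  carrier := {F | v ∉ F ∧ insert v F ∈ Δ}
  lower' _ _ hGF hF := ⟨fun h => hF.1 (hGF h), Δ.lower (Finset.insert_subset_insert v hGF) hF.2⟩

lemma link_le_deletion [DecidableEq V] (Δ : LowerSet (Finset V)) (v : V) :
    link Δ v ≤ deletion Δ v :=
  fun F hF => ⟨hF.1, Δ.lower (Finset.subset_insert v F) hF.2⟩

lemma deletion_le (Δ : LowerSet (Finset V)) (v : V) : deletion Δ v ≤ Δ := fun _ hF => hF.2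

variable {K : Type*} [Field K] {Δ Γ : LowerSet (Finset V)} {i j : ℤ}

lemma chains_mono (h : Δ ≤ Γ) (i : ℤ) : chains K Δ i ≤ chains K Γ i :=
  Finsupp.supported_mono fun _ hF => ⟨h hF.1, hF.2⟩

lemma chains_eq_bot (h : ∀ F ∈ Δ, (F.card : ℤ) ≠ i + 1) : chains K Δ i = ⊥ := by
  rw [chains, ← Finsupp.supported_empty]
  exact congrArg _ (Set.eq_empty_of_forall_notMem fun F hF => h F hF.1 hF.2)

lemma map_mem_chains (f : (Finset V →₀ K) →ₗ[K] (Finset V →₀ K))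
    (hf : ∀ F ∈ Δ, (F.card : ℤ) = i + 1 → f (Finsupp.single F 1) ∈ chains K Γ j)
    {c : Finset V →₀ K} (hc : c ∈ chains K Δ i) : f c ∈ chains K Γ j := by
  rw [chains, Finsupp.supported_eq_span_single] at hc
  induction hc using Submodule.span_induction with
  | mem x hx =>
    obtain ⟨F, ⟨hF, hcard⟩, rfl⟩ := hx
    exact hf F hF hcard
  | zero => simp
  | add x y _ _ hx hy => simpa using add_mem hx hy
  | smul a x _ hx => simpa using Submodule.smul_mem _ a hx

variable [LinearOrder V] {v : V} {c : Finset V →₀ K}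

lemma contract_mem_chains_link (hc : c ∈ chains K Δ (i + 1)) :
    contract K v c ∈ chains K (link Δ v) i := by
  refine map_mem_chains _ (fun F hF hcard => ?_) hc
  rw [contract_single]
  split_ifs with hv
  · refine Finsupp.single_mem_supported K _ ⟨⟨by simp, by rwa [Finset.insert_erase hv]⟩, ?_⟩
    have := Finset.card_erase_add_one hv
    omega
  · exact Submodule.zero_mem _

lemma cone_mem_chains (h : ∀ F ∈ Γ, v ∉ F → insert v F ∈ Δ) (hc : c ∈ chains K Γ i) :
    cone K v c ∈ chains K Δ (i + 1) := by
  refine map_mem_chains _ (fun F hF hcard => ?_) hc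
  rw [cone_single]
  split_ifs with hv
  · exact Submodule.zero_mem _
  · refine Finsupp.single_mem_supported K _ ⟨h F hF hv, ?_⟩
    rw [Finset.card_insert_of_notMem hv]
    push_cast
    omega

lemma cone_mem_chains_of_link (hc : c ∈ chains K (link Δ v) i) :
    cone K v c ∈ chains K Δ (i + 1) :=
  cone_mem_chains (Γ := link Δ v) (fun _ hF _ => hF.2) hc

lemma mem_chains_deletion :
    c ∈ chains K (deletion Δ v) i ↔ c ∈ chains K Δ i ∧ contract K v c = 0 := by
  refine ⟨fun hc => ⟨chains_mono (deletion_le Δ v) i hc, ?_⟩, fun ⟨hc, hv⟩ => ?_⟩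
  · rw [contract, Finsupp.linearCombination_apply]
    refine Finset.sum_eq_zero fun F hF => ?_
    simp [((Finsupp.mem_supported K c).1 hc hF).1.1]
  · rw [← contract_cone_of_contract_eq_zero hv]
    refine map_mem_chains (contract K v ∘ₗ cone K v) (fun F hF hcard => ?_) hc
    rw [LinearMap.comp_apply, cone_single]
    split_ifs with hvF
    · simp
    · rw [contract_single, if_pos (Finset.mem_insert_self v F), Finset.erase_insert hvF]
      exact Finsupp.single_mem_supported K _ ⟨⟨hvF, hF⟩, hcard⟩

lemma contract_eq_zero_of_mem_chains_link (hc : c ∈ chains K (link Δ v) i) : contract K v c = 0 :=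
  (mem_chains_deletion.1 (chains_mono (link_le_deletion Δ v) i hc)).2

lemma sub_cone_contract_mem_chains_deletion (hc : c ∈ chains K Δ (i + 1)) :
    c - cone K v (contract K v c) ∈ chains K (deletion Δ v) (i + 1) := by
  refine mem_chains_deletion.2
    ⟨sub_mem hc (cone_mem_chains_of_link (contract_mem_chains_link hc)), ?_⟩
  rw [map_sub, contract_cone_of_contract_eq_zero (contract_contract_self K v c), sub_self]

lemma contract_mem_cycles_link (hc : c ∈ cycles K Δ (i + 1)) :
    contract K v c ∈ cycles K (link Δ v) i := by
  refine ⟨contract_mem_chains_link hc.1, ?_⟩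
  rw [SetLike.mem_coe, LinearMap.mem_ker, boundary_contract, LinearMap.mem_ker.1 hc.2, map_zero,
    neg_zero]

lemma cycles_inf_ker_contract :
    cycles K Δ i ⊓ LinearMap.ker (contract K v) = cycles K (deletion Δ v) i := by
  have hchains : chains K Δ i ⊓ LinearMap.ker (contract K v) = chains K (deletion Δ v) i :=
    Submodule.ext fun _ => mem_chains_deletion.symm
  rw [cycles, inf_right_comm, hchains, cycles]

lemma map_contract_cycles (h : cycles K (deletion Δ v) i ≤ boundaries K (deletion Δ v) i) :
    (cycles K Δ (i + 1)).map (contract K v) = cycles K (link Δ v) i := by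
  apply le_antisymm
  · rintro _ ⟨z, hz, rfl⟩
    exact contract_mem_cycles_link hz
  · rintro b ⟨hb, hb0⟩
    obtain ⟨a, ha, hab⟩ := h ⟨chains_mono (link_le_deletion Δ v) i hb, hb0⟩
    obtain ⟨haΔ, hav⟩ := mem_chains_deletion.1 ha
    refine ⟨cone K v b - a, ⟨sub_mem (cone_mem_chains_of_link hb) haΔ, ?_⟩, ?_⟩
    · rw [SetLike.mem_coe, LinearMap.mem_ker, map_sub, boundary_cone, LinearMap.mem_ker.1 hb0, hab,
        map_zero, sub_zero, sub_self]
    · rw [map_sub, contract_cone_of_contract_eq_zero (contract_eq_zero_of_mem_chains_link hb), hav,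
        sub_zero]

lemma map_contract_boundaries :
    (boundaries K Δ (i + 1)).map (contract K v) = boundaries K (link Δ v) i := by
  apply le_antisymm
  · rintro _ ⟨_, ⟨c, hc, rfl⟩, rfl⟩
    refine ⟨- contract K v c, neg_mem (contract_mem_chains_link hc), ?_⟩
    rw [map_neg, boundary_contract, neg_neg]
  · rintro _ ⟨b, hb, rfl⟩
    refine ⟨_, ⟨- cone K v b, neg_mem (cone_mem_chains_of_link hb), rfl⟩, ?_⟩
    rw [map_neg, map_neg, ← boundary_contract,
      contract_cone_of_contract_eq_zero (contract_eq_zero_of_mem_chains_link hb)]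

lemma boundaries_inf_ker_contract (h : cycles K (link Δ v) i ≤ boundaries K (link Δ v) i) :
    boundaries K Δ i ⊓ LinearMap.ker (contract K v) = boundaries K (deletion Δ v) i := by
  apply le_antisymm
  · rintro _ ⟨⟨c, hc, rfl⟩, hz⟩
    have hb0 : boundary K (contract K v c) = 0 := by
      rw [boundary_contract, LinearMap.mem_ker.1 hz, neg_zero]
    obtain ⟨b, hb, hbc⟩ := h ⟨contract_mem_chains_link hc, hb0⟩
    refine ⟨_, add_mem (sub_cone_contract_mem_chains_deletion hc)
      (chains_mono (link_le_deletion Δ v) _ hb), ?_⟩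
    rw [map_add, map_sub, boundary_cone, hb0, map_zero, sub_zero, hbc, sub_add_cancel]
  · rintro _ ⟨c, hc, rfl⟩
    exact ⟨⟨c, chains_mono (deletion_le Δ v) _ hc, rfl⟩,
      (mem_chains_deletion.1 (boundary_mem_chains K _ _ hc)).2⟩

lemma cycles_le_boundaries_of_deletion_link
    (hdel : cycles K (deletion Δ v) (i + 1) ≤ boundaries K (deletion Δ v) (i + 1))
    (hlink : cycles K (link Δ v) i ≤ boundaries K (link Δ v) i) :
    cycles K Δ (i + 1) ≤ boundaries K Δ (i + 1) := by
  intro z hz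
  have hz0 : boundary K z = 0 := hz.2
  obtain ⟨b, hb, hbz⟩ := hlink (contract_mem_cycles_link hz)
  -- Adding `∂ (cone b)` moves `z` within its homology class off the vertex `v`.
  have hmoved : z + boundary K (cone K v b) ∈ cycles K (deletion Δ v) (i + 1) := by
    refine ⟨?_, by
      rw [SetLike.mem_coe, LinearMap.mem_ker, map_add, hz0, boundary_boundary, add_zero]⟩
    have hcone : z + boundary K (cone K v b) = z - cone K v (contract K v z) + b := by
      rw [boundary_cone, hbz]
      abel
    rw [hcone]
    exact add_mem (sub_cone_contract_mem_chains_deletion hz.1)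
      (chains_mono (link_le_deletion Δ v) _ hb)
  obtain ⟨a, ha, haz⟩ := hdel hmoved
  refine ⟨a - cone K v b, sub_mem (chains_mono (deletion_le Δ v) _ ha)
    (cone_mem_chains_of_link hb), ?_⟩
  rw [map_sub, haz, add_sub_cancel_right]

end DeletionLink

section Concentration

variable {V : Type*} [LinearOrder V] (K : Type*) [Field K]

/-- The reduced homology of `Δ` vanishes outside degree `e`, where it has dimension `r`. For `r = 0`
the complex is acyclic and `e` is arbitrary. -/
def IsConcentrated (Δ : LowerSet (Finset V)) (e : ℤ) (r : ℕ) : Prop :=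
  (∀ i ≠ e, Subsingleton (ReducedHomology K Δ i)) ∧ Module.finrank K (ReducedHomology K Δ e) = r

variable {K} {Δ : LowerSet (Finset V)} {e i : ℤ} {r : ℕ}

lemma subsingleton_reducedHomology_iff :
    Subsingleton (ReducedHomology K Δ i) ↔ cycles K Δ i ≤ boundaries K Δ i :=
  Submodule.Quotient.subsingleton_iff.trans Submodule.submoduleOf_eq_top

lemma isConcentrated_zero (h : ∀ i, cycles K Δ i ≤ boundaries K Δ i) (e : ℤ) :
    IsConcentrated K Δ e 0 :=
  have hsub i : Subsingleton (ReducedHomology K Δ i) := subsingleton_reducedHomology_iff.2 (h i)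
  ⟨fun i _ => hsub i, have := hsub e; Module.finrank_zero_of_subsingleton⟩

lemma isConcentrated_zero_of_cone (v : V) (h : ∀ F ∈ Δ, insert v F ∈ Δ) (e : ℤ) :
    IsConcentrated K Δ e 0 := by
  refine isConcentrated_zero (fun i z hz => ?_) e
  refine ⟨cone K v z, cone_mem_chains (fun F hF _ => h F hF) hz.1, ?_⟩
  rw [boundary_cone, LinearMap.mem_ker.1 hz.2, map_zero, sub_zero]

lemma isConcentrated_bot (e : ℤ) : IsConcentrated K (⊥ : LowerSet (Finset V)) e 0 := by
  refine isConcentrated_zero (fun i => ?_) e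
  rw [cycles, chains_eq_bot fun _ hF => absurd hF LowerSet.notMem_bot, bot_inf_eq]
  exact bot_le

lemma finrank_eq_finrank_map_add_finrank_inf_ker {E F : Type*} [AddCommGroup E] [Module K E]
    [AddCommGroup F] [Module K F] (f : E →ₗ[K] F) (S : Submodule K E) [FiniteDimensional K S] :
    Module.finrank K S =
      Module.finrank K (S.map f) + Module.finrank K ↥(S ⊓ LinearMap.ker f) := by
  have h := LinearMap.finrank_range_add_finrank_ker (f.domRestrict S)
  rw [LinearMap.range_domRestrict, LinearMap.ker_domRestrict] at h
  rw [← h, ← Submodule.map_comap_subtype, Submodule.finrank_map_subtype_eq]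

section Finite

variable [Finite V]

lemma finrank_reducedHomology_add_finrank_boundaries (Δ : LowerSet (Finset V)) (i : ℤ) :
    Module.finrank K (ReducedHomology K Δ i) + Module.finrank K (boundaries K Δ i) =
      Module.finrank K (cycles K Δ i) := by
  rw [← (Submodule.submoduleOfEquivOfLe (boundaries_le_cycles K Δ i)).finrank_eq]
  exact Submodule.finrank_quotient_add_finrank _

lemma IsConcentrated.nonempty_linearEquiv (h : IsConcentrated K Δ e r) :
    Nonempty (ReducedHomology K Δ e ≃ₗ[K] (Fin r → K)) :=
  FiniteDimensional.nonempty_linearEquiv_of_finrank_eq (by rw [h.2, Module.finrank_fin_fun])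

lemma isConcentrated_singleton_empty (h : ∀ F, F ∈ Δ ↔ F = ∅) : IsConcentrated K Δ (-1) 1 := by
  have hbot : ∀ i ≠ -1, chains K Δ i = ⊥ := by
    refine fun i hi => chains_eq_bot fun F hF => ?_
    rw [(h F).1 hF, Finset.card_empty]
    omega
  have hcycles : cycles K Δ (-1) = K ∙ Finsupp.single ∅ 1 := by
    have hchains : chains K Δ (-1) = K ∙ Finsupp.single ∅ 1 := by
      rw [chains, ← Set.image_singleton (f := fun F : Finset V => Finsupp.single F (1 : K)),
        ← Finsupp.supported_eq_span_single]
      congr 1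
      ext F
      simp +contextual [h]
    rw [cycles, hchains, inf_eq_left, Submodule.span_singleton_le_iff_mem, LinearMap.mem_ker,
      boundary_single, Finset.sum_empty]
  refine ⟨fun i hi => subsingleton_reducedHomology_iff.2 ?_, ?_⟩
  · rw [cycles, hbot i hi, bot_inf_eq]
    exact bot_le
  · have hdim := finrank_reducedHomology_add_finrank_boundaries (K := K) Δ (-1)
    have hcycles_finrank : Module.finrank K (cycles K Δ (-1)) = 1 := by
      rw [hcycles]
      exact finrank_span_singleton (by simp)
    have hboundaries_finrank : Module.finrank K (boundaries K Δ (-1)) = 0 := by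
      rw [boundaries, hbot (-1 + 1) (by omega), Submodule.map_bot, finrank_bot]
    omega

/-- Under the concentration hypotheses, the long exact sequence
`⋯ → H̃ᵢ(deletion) → H̃ᵢ(Δ) → H̃ᵢ₋₁(link) → H̃ᵢ₋₁(deletion) → ⋯`
reduces to a short exact sequence in degree `i = e + 1`. -/
theorem IsConcentrated.of_deletion_link {v : V} {r₁ r₂ : ℕ}
    (hdel : IsConcentrated K (deletion Δ v) (e + 1) r₁)
    (hlink : IsConcentrated K (link Δ v) e r₂) : IsConcentrated K Δ (e + 1) (r₁ + r₂) := by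
  have hdel_le : ∀ i ≠ e + 1, cycles K (deletion Δ v) i ≤ boundaries K (deletion Δ v) i :=
    fun i hi => subsingleton_reducedHomology_iff.1 (hdel.1 i hi)
  have hlink_le : ∀ i ≠ e, cycles K (link Δ v) i ≤ boundaries K (link Δ v) i :=
    fun i hi => subsingleton_reducedHomology_iff.1 (hlink.1 i hi)
  refine ⟨fun i hi => subsingleton_reducedHomology_iff.2 ?_, ?_⟩
  · obtain ⟨i, rfl⟩ : ∃ j, i = j + 1 := ⟨i - 1, (sub_add_cancel i 1).symm⟩
    exact cycles_le_boundaries_of_deletion_link (hdel_le _ hi) (hlink_le _ (by omega))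
  · have hcycles := finrank_eq_finrank_map_add_finrank_inf_ker (contract K v) (cycles K Δ (e + 1))
    have hboundaries :=
      finrank_eq_finrank_map_add_finrank_inf_ker (contract K v) (boundaries K Δ (e + 1))
    rw [map_contract_cycles (hdel_le e (by omega)), cycles_inf_ker_contract] at hcycles
    rw [map_contract_boundaries, boundaries_inf_ker_contract (hlink_le (e + 1) (by omega))]
      at hboundaries
    have hΔ := finrank_reducedHomology_add_finrank_boundaries (K := K) Δ (e + 1)
    have hD := finrank_reducedHomology_add_finrank_boundaries (K := K) (deletion Δ v) (e + 1)
    have hL := finrank_reducedHomology_add_finrank_boundaries (K := K) (link Δ v) e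
    rw [hdel.2] at hD
    rw [hlink.2] at hL
    omega

end Finite

end Concentration

section Avoiding

variable {V : Type*}

/-- The complex of all finite subsets of `A` that are disjoint from some member of the family `𝓔`.
A complement complex `⟨V \ F₁, …, V \ F_k⟩` is of this form with `A = V` and `𝓔 = {F₁, …, F_k}`. -/
def avoiding (A : Finset V) (𝓔 : Set (Set V)) : LowerSet (Finset V) where
  carrier := {S | S ⊆ A ∧ ∃ E ∈ 𝓔, Disjoint (S : Set V) E}
  lower' _ _ hTS hS := ⟨hTS.trans hS.1,
    hS.2.imp fun _ hE => ⟨hE.1, hE.2.mono_left (Finset.coe_subset.2 hTS)⟩⟩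

variable {A B : Finset V} {𝓔 𝓕 : Set (Set V)} {v : V}

lemma avoiding_le (h : ∀ E ∈ 𝓔, ∃ F ∈ 𝓕, ∀ v ∈ A, v ∈ F → v ∈ E) :
    avoiding A 𝓔 ≤ avoiding A 𝓕 := by
  rintro S ⟨hS, E, hE, hd⟩
  obtain ⟨F, hF, hFE⟩ := h E hE
  exact ⟨hS, F, hF, Set.disjoint_left.2 fun v hv hvF =>
    Set.disjoint_left.1 hd hv (hFE v (hS hv) hvF)⟩

lemma avoiding_congr (h𝓔 : ∀ E ∈ 𝓔, ∃ F ∈ 𝓕, ∀ v ∈ A, v ∈ F → v ∈ E)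
    (h𝓕 : ∀ F ∈ 𝓕, ∃ E ∈ 𝓔, ∀ v ∈ A, v ∈ E → v ∈ F) : avoiding A 𝓔 = avoiding A 𝓕 :=
  le_antisymm (avoiding_le h𝓔) (avoiding_le h𝓕)

lemma mem_avoiding_iff_eq_empty (h𝓔 : 𝓔.Nonempty) (h : ∀ E ∈ 𝓔, (A : Set V) ⊆ E)
    (S : Finset V) : S ∈ avoiding A 𝓔 ↔ S = ∅ := by
  refine ⟨?_, ?_⟩
  · rintro ⟨hS, E, hE, hd⟩
    have hSE : (S : Set V) ⊆ E := (Finset.coe_subset.2 hS).trans (h E hE)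
    exact Finset.coe_eq_empty.1 (Set.subset_empty_iff.1 (hd subset_rfl hSE))
  · rintro rfl
    obtain ⟨E, hE⟩ := h𝓔
    exact ⟨Finset.empty_subset A, E, hE, by simp⟩

lemma complementComplex_lowerClosure [Fintype V] [DecidableEq V] {𝓐 : Set (Finset V)}
    (h : IsAntichain (· ⊆ ·) 𝓐) :
    complementComplex (lowerClosure 𝓐) =
      avoiding Finset.univ ((fun F : Finset V => (F : Set V)) '' 𝓐) := by
  have hfacets : facets (lowerClosure 𝓐) = 𝓐 :=
    Set.ext fun F => IsAntichain.maximal_mem_lowerClosure_iff_mem h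
  ext S
  rw [complementComplex, hfacets]
  change S ∈ lowerClosure _ ↔ S ⊆ Finset.univ ∧ ∃ E ∈ _, Disjoint (S : Set V) E
  simp only [mem_lowerClosure, Set.exists_mem_image, Finset.subset_univ, true_and,
    Finset.disjoint_coe, Finset.subset_compl_iff_disjoint_right]

variable [DecidableEq V]

lemma deletion_avoiding_insert (hv : v ∉ A) :
    deletion (avoiding (insert v A) 𝓔) v = avoiding A 𝓔 := by
  ext S
  change (v ∉ S ∧ S ⊆ insert v A ∧ _) ↔ (S ⊆ A ∧ _)
  rw [← Finset.erase_insert hv, Finset.subset_erase, Finset.erase_insert hv]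
  tauto

lemma link_avoiding_insert (hv : v ∉ A) :
    link (avoiding (insert v A) 𝓔) v = avoiding A {E ∈ 𝓔 | v ∉ E} := by
  ext S
  change (v ∉ S ∧ insert v S ⊆ insert v A ∧ ∃ E ∈ 𝓔, Disjoint (↑(insert v S)) E) ↔
    (S ⊆ A ∧ ∃ E, (E ∈ 𝓔 ∧ v ∉ E) ∧ Disjoint (S : Set V) E)
  nth_rw 2 [← Finset.erase_insert hv]
  simp only [Finset.subset_erase, Finset.insert_subset_iff, Finset.mem_insert_self, true_and,
    Finset.coe_insert, Set.disjoint_insert_left, and_assoc]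
  tauto

end Avoiding

section AvoidingHomology

variable {V : Type*} [LinearOrder V] {K : Type*} [Field K] {A B : Finset V} {𝓔 : Set (Set V)}
  {e : ℤ} {r r₁ r₂ : ℕ} {v : V}

lemma isConcentrated_avoiding_of_notMem (hv : v ∈ A) (h : ∀ E ∈ 𝓔, v ∉ E) (e : ℤ) :
    IsConcentrated K (avoiding A 𝓔) e 0 := by
  refine isConcentrated_zero_of_cone v ?_ e
  rintro S ⟨hS, E, hE, hd⟩
  refine ⟨Finset.insert_subset hv hS, E, hE, ?_⟩
  rw [Finset.coe_insert, Set.disjoint_insert_left]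
  exact ⟨h E hE, hd⟩

lemma isConcentrated_avoiding_of_disjoint {E : Set V} (hE : E ∈ 𝓔) (hAE : Disjoint (A : Set V) E)
    (hA : A.Nonempty) (e : ℤ) : IsConcentrated K (avoiding A 𝓔) e 0 := by
  obtain ⟨v, hv⟩ := hA
  refine isConcentrated_zero_of_cone v ?_ e
  rintro S ⟨hS, -⟩
  have hvS := Finset.insert_subset hv hS
  exact ⟨hvS, E, hE, hAE.mono_left (Finset.coe_subset.2 hvS)⟩

variable [Finite V]

lemma isConcentrated_avoiding_insert (hv : v ∉ A) (h₁ : IsConcentrated K (avoiding A 𝓔) (e + 1) r₁)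
    (h₂ : IsConcentrated K (avoiding A {E ∈ 𝓔 | v ∉ E}) e r₂) :
    IsConcentrated K (avoiding (insert v A) 𝓔) (e + 1) (r₁ + r₂) := by
  rw [← deletion_avoiding_insert hv] at h₁
  rw [← link_avoiding_insert hv] at h₂
  exact h₁.of_deletion_link h₂

/-- A vertex `v` is dominated by `w` if all members of the family through `w` pass through `v`; the
link of `v` is then a cone with apex `w`, so deleting `v` does not change the homology. -/
lemma isConcentrated_avoiding_of_dominated (hBA : B ⊆ A)
    (hdom : ∀ v ∈ A, v ∉ B → ∃ w ∈ B, ∀ E ∈ 𝓔, w ∈ E → v ∈ E)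
    (h : IsConcentrated K (avoiding B 𝓔) e r) : IsConcentrated K (avoiding A 𝓔) e r := by
  suffices hunion : ∀ C ⊆ A \ B, IsConcentrated K (avoiding (B ∪ C) 𝓔) e r by
    simpa [Finset.union_sdiff_of_subset hBA] using hunion (A \ B) subset_rfl
  intro C
  induction C using Finset.induction with
  | empty => exact fun _ => by rwa [Finset.union_empty]
  | insert v C hvC ih =>
    intro hC
    obtain ⟨hv, hC⟩ := Finset.insert_subset_iff.1 hC
    obtain ⟨hvA, hvB⟩ := Finset.mem_sdiff.1 hv
    obtain ⟨w, hwB, hw⟩ := hdom v hvA hvB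
    have hlink : IsConcentrated K (avoiding (B ∪ C) {E ∈ 𝓔 | v ∉ E}) (e - 1) 0 :=
      isConcentrated_avoiding_of_notMem (Finset.mem_union_left C hwB)
        (fun E hE hwE => hE.2 (hw E hE.1 hwE)) _
    rw [Finset.union_insert, ← sub_add_cancel e 1, ← add_zero r]
    refine isConcentrated_avoiding_insert (by simp [hvB, hvC]) ?_ hlink
    rw [sub_add_cancel]
    exact ih hC

end AvoidingHomology

end SimplicialHomology

namespace CyclePaths

open SimplicialHomology

section Segments

variable {V : Type*} (pos : V → ℕ) (A : Finset V)

/-- The vertices of `A` whose position lies in `[a, b)`. -/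
def window (a b : ℕ) : Finset V := {v ∈ A | pos v ∈ Set.Ico a b}

/-- The initial segment `[a, a + c)` and all segments `[i, i + t)` of the interval `[a, b)`, as sets
of vertices; those which do not fit into the interval are omitted. -/
def segments (t c a b : ℕ) : Set (Set V) :=
  {E | (a + c ≤ b ∧ E = pos ⁻¹' Set.Ico a (a + c)) ∨
    ∃ i, a ≤ i ∧ i + t ≤ b ∧ E = pos ⁻¹' Set.Ico i (i + t)}

/-- The sets of vertices in the window `[a, b)` that avoid its initial segment of length `c` or one
of its segments of length `t`. -/
def segmentComplex (t c a b : ℕ) : LowerSet (Finset V) :=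
  avoiding (window pos A a b) (segments pos t c a b)

variable {pos A} {t c a b q : ℕ}

lemma mem_window {v : V} : v ∈ window pos A a b ↔ v ∈ A ∧ a ≤ pos v ∧ pos v < b := by
  simp [window]

lemma segmentComplex_eq_bot (hct : c ≤ t) (hb : b < a + c) : segmentComplex pos A t c a b = ⊥ := by
  refine le_bot_iff.1 ?_
  rintro S ⟨-, E, ⟨hE, -⟩ | ⟨i, hi, hib, -⟩, -⟩ <;> omega

lemma mem_segmentComplex_iff_eq_empty (hct : c ≤ t) (hb : b = a + c) (S : Finset V) :
    S ∈ segmentComplex pos A t c a b ↔ S = ∅ := by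
  refine mem_avoiding_iff_eq_empty ⟨_, Or.inl ⟨hb.ge, rfl⟩⟩ ?_ S
  rintro E (⟨-, rfl⟩ | ⟨i, hi, hib, rfl⟩) v hv
  all_goals
    have hv := (mem_window.1 hv).2
    rw [Set.mem_preimage, Set.mem_Ico]
    omega

/-- Among the segments missing the first vertex, those beginning before `a + c` all contain
`[a + c, a + t + 1)`, which is what the segment `[a + 1, a + t + 1)` leaves of the remaining
window. -/
lemma avoiding_segments_notMem (hc : 0 < c) (hct : c ≤ t) {v : V} (hv : pos v = a) :
    avoiding (window pos A (a + c) b) {E ∈ segments pos t c a b | v ∉ E} =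
      segmentComplex pos A t (t + 1 - c) (a + c) b := by
  refine avoiding_congr ?_ ?_
  · rintro E ⟨⟨-, rfl⟩ | ⟨i, hi, hib, rfl⟩, hvE⟩ <;>
      rw [Set.mem_preimage, Set.mem_Ico] at hvE
    · omega
    rcases le_or_gt (a + c) i with hci | hci
    · exact ⟨_, Or.inr ⟨i, hci, hib, rfl⟩, fun _ _ h => h⟩
    · refine ⟨_, Or.inl ⟨by omega, rfl⟩, fun w _ hw => ?_⟩
      rw [Set.mem_preimage, Set.mem_Ico] at hw ⊢
      omega
  · rintro E (⟨hb, rfl⟩ | ⟨i, hi, hib, rfl⟩)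
    · refine ⟨pos ⁻¹' Set.Ico (a + 1) (a + 1 + t), ⟨Or.inr ⟨a + 1, by omega, by omega, rfl⟩, ?_⟩,
        fun w hwA hw => ?_⟩
      · rw [Set.mem_preimage, Set.mem_Ico]
        omega
      · rw [mem_window] at hwA
        rw [Set.mem_preimage, Set.mem_Ico] at hw ⊢
        omega
    · refine ⟨_, ⟨Or.inr ⟨i, by omega, hib, rfl⟩, ?_⟩, fun _ _ h => h⟩
      rw [Set.mem_preimage, Set.mem_Ico]
      omega

variable [LinearOrder V] [Finite V] {K : Type*} [Field K] {e : ℤ} {r : ℕ}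

/-- The first vertex dominates the positions `a + 1, …, a + c - 1`. Once these are deleted, its
deletion is a simplex and its link is the complex on the right. -/
lemma isConcentrated_segmentComplex_succ (hpos : ∀ j < b, ∃ v ∈ A, pos v = j)
    (hc : 0 < c) (hct : c ≤ t) (hb : a + c < b)
    (h : IsConcentrated K (segmentComplex pos A t (t + 1 - c) (a + c) b) e r) :
    IsConcentrated K (segmentComplex pos A t c a b) (e + 1) r := by
  obtain ⟨v, hvA, hva⟩ := hpos a (by omega)
  obtain ⟨w, hwA, hwa⟩ := hpos (a + c) hb
  have hvB : v ∉ window pos A (a + c) b := by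
    rw [mem_window]
    omega
  have hwB : w ∈ window pos A (a + c) b := mem_window.2 ⟨hwA, by omega⟩
  refine isConcentrated_avoiding_of_dominated (B := insert v (window pos A (a + c) b)) ?_ ?_ ?_
  · refine Finset.insert_subset (mem_window.2 ⟨hvA, by omega⟩) fun x hx => ?_
    rw [mem_window] at hx ⊢
    exact ⟨hx.1, by omega⟩
  · intro x hx hxB
    refine ⟨v, Finset.mem_insert_self _ _, ?_⟩
    have hxc : pos x < a + c := by
      by_contra! hxc
      exact hxB (Finset.mem_insert_of_mem
        (mem_window.2 ⟨(mem_window.1 hx).1, hxc, (mem_window.1 hx).2.2⟩))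
    have hxa := (mem_window.1 hx).2.1
    rintro E (⟨-, rfl⟩ | ⟨i, hi, -, rfl⟩) <;>
      rw [Set.mem_preimage, Set.mem_Ico, Set.mem_preimage, Set.mem_Ico] <;> omega
  · have hdel : IsConcentrated K (avoiding (window pos A (a + c) b) (segments pos t c a b))
        (e + 1) 0 := by
      refine isConcentrated_avoiding_of_disjoint (Or.inl ⟨hb.le, rfl⟩)
        (Set.disjoint_left.2 fun x hx hxE => ?_) ⟨w, hwB⟩ _
      rw [Finset.mem_coe, mem_window] at hx
      rw [Set.mem_preimage, Set.mem_Ico] at hxE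
      omega
    rw [← zero_add r]
    refine isConcentrated_avoiding_insert hvB hdel ?_
    rwa [avoiding_segments_notMem hc hct hva]

lemma isConcentrated_segmentComplex_add_two (hpos : ∀ j < b, ∃ v ∈ A, pos v = j)
    (hc : 0 < c) (hct : c ≤ t) (hb : a + (t + 1) < b)
    (h : IsConcentrated K (segmentComplex pos A t c (a + (t + 1)) b) e r) :
    IsConcentrated K (segmentComplex pos A t c a b) (e + 2) r := by
  have htwice : t + 1 - (t + 1 - c) = c ∧ a + c + (t + 1 - c) = a + (t + 1) := by omega
  rw [← one_add_one_eq_two, ← add_assoc]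
  refine isConcentrated_segmentComplex_succ hpos hc hct (by omega)
    (isConcentrated_segmentComplex_succ hpos (by omega) (by omega) (by omega) ?_)
  rwa [htwice.1, htwice.2]

lemma isConcentrated_segmentComplex_of_eq_mul_add (hpos : ∀ j < b, ∃ v ∈ A, pos v = j)
    (hc : 0 < c) (hct : c ≤ t) (hb : b = a + q * (t + 1) + c) :
    IsConcentrated K (segmentComplex pos A t c a b) (2 * q - 1) 1 := by
  induction q generalizing a with
  | zero =>
    simpa using isConcentrated_singleton_empty (K := K)
      (mem_segmentComplex_iff_eq_empty (pos := pos) (A := A) hct (by simpa using hb))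
  | succ q ih =>
    rw [Nat.succ_mul] at hb
    have h := isConcentrated_segmentComplex_add_two hpos hc hct (by omega)
      (ih (a := a + (t + 1)) (by omega))
    convert h using 1
    push_cast
    ring

lemma isConcentrated_segmentComplex_of_eq_mul (hpos : ∀ j < b, ∃ v ∈ A, pos v = j)
    (hc : 0 < c) (hct : c ≤ t) (hb : b = a + (q + 1) * (t + 1)) :
    IsConcentrated K (segmentComplex pos A t c a b) (2 * q) 1 := by
  rw [Nat.succ_mul] at hb
  rw [← sub_add_cancel (2 * (q : ℤ)) 1]
  exact isConcentrated_segmentComplex_succ hpos hc hct (by omega)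
    (isConcentrated_segmentComplex_of_eq_mul_add hpos (by omega) (by omega) (by omega))

lemma isConcentrated_segmentComplex_zero (hpos : ∀ j < b, ∃ v ∈ A, pos v = j)
    (hc : 0 < c) (hct : c ≤ t) {s : ℕ} (hs : 0 < s) (hst : s ≤ t) (hsc : s ≠ c)
    (hb : b = a + q * (t + 1) + s) (e : ℤ) :
    IsConcentrated K (segmentComplex pos A t c a b) e 0 := by
  induction q generalizing a e with
  | zero =>
    rcases lt_or_gt_of_ne hsc with hsc | hsc
    · rw [segmentComplex_eq_bot hct (by omega)]
      exact isConcentrated_bot e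
    · rw [← sub_add_cancel e 1]
      refine isConcentrated_segmentComplex_succ hpos hc hct (by omega) ?_
      rw [segmentComplex_eq_bot (by omega) (by omega)]
      exact isConcentrated_bot _
  | succ q ih =>
    rw [Nat.succ_mul] at hb
    rw [← sub_add_cancel e 2]
    exact isConcentrated_segmentComplex_add_two hpos hc hct (by omega) (ih (by omega) _)

end Segments

section Cyclic

variable {V : Type*} (pos : V → ℕ) (A : Finset V)

/-- The segment of length `t` starting at `i < k` on the cycle of positions `0, …, k - 1`: where
`i + t` exceeds `k` it continues with the positions below `i + t - k` (a truncated subtraction). For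
`t ≥ k` it is the whole cycle. Positions from `k` on are irrelevant. -/
def cyclicSegment (t k i : ℕ) : Set ℕ := Set.Ico i (i + t) ∪ Set.Iio (i + t - k)

/-- The sets of vertices at positions below `b` that avoid some cyclic segment of length `t` of the
cycle of positions `0, …, k - 1`. -/
def cyclicComplex (t k b : ℕ) : LowerSet (Finset V) :=
  avoiding (window pos A 0 b) {E | ∃ i < k, E = pos ⁻¹' cyclicSegment t k i}

variable {pos A} {t u p d x i j k : ℕ}

lemma mem_cyclicSegment : j ∈ cyclicSegment t k i ↔ (i ≤ j ∧ j < i + t) ∨ j < i + t - k := by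
  simp [cyclicSegment]

lemma window_succ [DecidableEq V] {b : ℕ} {v : V} (hinj : Set.InjOn pos A) (hvA : v ∈ A)
    (hv : pos v = b) : window pos A 0 (b + 1) = insert v (window pos A 0 b) := by
  ext w
  simp only [Finset.mem_insert, mem_window]
  constructor
  · rintro ⟨hwA, -, hw⟩
    rcases Nat.lt_succ_iff_lt_or_eq.1 hw with hw | hw
    · exact Or.inr ⟨hwA, Nat.zero_le _, hw⟩
    · exact Or.inl (hinj hwA hvA (hw.trans hv.symm))
  · rintro (rfl | ⟨hwA, -, hw⟩)
    · exact ⟨hvA, Nat.zero_le _, by omega⟩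
    · exact ⟨hwA, Nat.zero_le _, by omega⟩

/-- A cyclic segment missing the position `u + x` lies below it, or else starts above it and then
leaves an initial segment of the window of length at least `x + 1`. -/
lemma avoiding_cyclicSegment_notMem (hu : 0 < u) (hx : x < t) {v : V} (hv : pos v = u + x) :
    avoiding (window pos A 0 (u + x))
        {E ∈ {E | ∃ i < u + t, E = pos ⁻¹' cyclicSegment t (u + t) i} | v ∉ E} =
      segmentComplex pos A t (x + 1) 0 (u + x) := by
  refine avoiding_congr ?_ ?_
  · rintro E ⟨⟨i, -, rfl⟩, hvE⟩
    rw [Set.mem_preimage, mem_cyclicSegment] at hvE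
    rcases le_or_gt (i + t) (u + x) with hit | hit
    · exact ⟨_, Or.inr ⟨i, i.zero_le, hit, rfl⟩, fun w _ hw => Or.inl hw⟩
    · refine ⟨_, Or.inl ⟨by omega, rfl⟩, fun w _ hw => ?_⟩
      rw [Set.mem_preimage, Set.mem_Ico] at hw
      rw [Set.mem_preimage, mem_cyclicSegment]
      omega
  · rintro E (⟨-, rfl⟩ | ⟨i, -, hi, rfl⟩)
    · -- The next position on the cycle is `u + x + 1`, or `0` if `x + 1 = t`.
      obtain ⟨i, hi⟩ : ∃ i, (x + 1 < t ∧ i = u + x + 1) ∨ (x + 1 = t ∧ i = 0) := by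
        rcases Nat.lt_or_eq_of_le hx with hx | hx
        · exact ⟨_, Or.inl ⟨hx, rfl⟩⟩
        · exact ⟨_, Or.inr ⟨hx, rfl⟩⟩
      refine ⟨_, ⟨⟨i, by omega, rfl⟩, ?_⟩, fun w hwA hw => ?_⟩
      · rw [Set.mem_preimage, mem_cyclicSegment]
        omega
      · rw [mem_window] at hwA
        rw [Set.mem_preimage, mem_cyclicSegment] at hw
        rw [Set.mem_preimage, Set.mem_Ico]
        omega
    · refine ⟨_, ⟨⟨i, by omega, rfl⟩, ?_⟩, fun w _ hw => ?_⟩ <;>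
        simp only [Set.mem_preimage, mem_cyclicSegment, Set.mem_Ico] at * <;> omega

variable [LinearOrder V] [Finite V] {K : Type*} [Field K] {e : ℤ}

/-- The last `t` positions of the cycle are restored one by one, starting from a simplex. -/
lemma isConcentrated_cyclicComplex_sum (hinj : Set.InjOn pos A)
    (hpos : ∀ j < u + t, ∃ v ∈ A, pos v = j) (hu : 0 < u) {r : ℕ → ℕ}
    (h : ∀ x < t, IsConcentrated K (segmentComplex pos A t (x + 1) 0 (u + x)) e (r x))
    (hx : x ≤ t) :
    IsConcentrated K (cyclicComplex pos A t (u + t) (u + x)) (e + 1)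
      (∑ y ∈ Finset.range x, r y) := by
  induction x with
  | zero =>
    obtain ⟨v, hvA, hv⟩ := hpos 0 (by omega)
    -- The cyclic segment starting at `u`; if `t = 0`, all of them are empty.
    have hdisj : Disjoint (window pos A 0 u : Set V)
        (pos ⁻¹' cyclicSegment t (u + t) (min u (u + t - 1))) := by
      refine Set.disjoint_left.2 fun w hw hwE => ?_
      rw [Finset.mem_coe, mem_window] at hw
      rw [Set.mem_preimage, mem_cyclicSegment] at hwE
      omega
    exact isConcentrated_avoiding_of_disjoint (Set.mem_ofPred.2 ⟨_, by omega, rfl⟩) hdisj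
      ⟨v, mem_window.2 ⟨hvA, by omega⟩⟩ _
  | succ x ih =>
    obtain ⟨v, hvA, hv⟩ := hpos (u + x) (by omega)
    rw [Finset.sum_range_succ, cyclicComplex, ← add_assoc, window_succ hinj hvA hv]
    refine isConcentrated_avoiding_insert ?_ (ih (by omega)) ?_
    · rw [mem_window]
      omega
    · rw [avoiding_cyclicSegment_notMem hu hx hv]
      exact h x hx

theorem isConcentrated_cyclicComplex_of_eq_mul (hinj : Set.InjOn pos A)
    (hpos : ∀ j < k, ∃ v ∈ A, pos v = j) (hk : k = (p + 1) * (t + 1)) :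
    IsConcentrated K (cyclicComplex pos A t k k) (2 * p) t := by
  obtain rfl : k = p * (t + 1) + 1 + t := by rw [hk]; ring
  have h := isConcentrated_cyclicComplex_sum (K := K) (e := 2 * p - 1) (r := fun _ => 1) hinj hpos
    (Nat.succ_pos _) (fun x hx => isConcentrated_segmentComplex_of_eq_mul_add
      (fun j hj => hpos j (by omega)) (Nat.succ_pos x) hx (by omega)) le_rfl
  simpa using h

theorem isConcentrated_cyclicComplex_of_eq_mul_add (hinj : Set.InjOn pos A)
    (hpos : ∀ j < k, ∃ v ∈ A, pos v = j) (hd0 : d ≠ 0) (hd : d ≤ t)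
    (hk : k = (p + 1) * (t + 1) + d) :
    IsConcentrated K (cyclicComplex pos A t k k) (2 * p + 1) 1 := by
  obtain rfl : k = p * (t + 1) + d + 1 + t := by rw [hk]; ring
  have h := isConcentrated_cyclicComplex_sum (K := K) (e := 2 * p) (x := t)
    (r := fun x => if x = t - d then 1 else 0) hinj hpos (Nat.succ_pos _) (fun x hx => ?_) le_rfl
  · rwa [Finset.sum_ite_eq', if_pos (Finset.mem_range.2 (by omega))] at h
  have hpos' : ∀ j < p * (t + 1) + d + 1 + x, ∃ v ∈ A, pos v = j := fun j hj => hpos j (by omega)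
  rcases lt_trichotomy (x + d) t with hxd | hxd | hxd
  · rw [if_neg (by omega)]
    exact isConcentrated_segmentComplex_zero hpos' (Nat.succ_pos x) hx (s := x + d + 1)
      (q := p) (by omega) (by omega) (by omega) (by omega) _
  · rw [if_pos (by omega)]
    exact isConcentrated_segmentComplex_of_eq_mul hpos' (Nat.succ_pos x) hx
      (by rw [Nat.succ_mul]; omega)
  · rw [if_neg (by omega)]
    exact isConcentrated_segmentComplex_zero hpos' (Nat.succ_pos x) hx (q := p + 1)
      (s := x + d - t) (by omega) (by omega) (by omega) (by rw [Nat.succ_mul]; omega) _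

theorem isConcentrated_cyclicComplex_of_le (hk : 0 < k) (hkt : k ≤ t) :
    IsConcentrated K (cyclicComplex pos A t k k) (-1) 1 := by
  refine isConcentrated_singleton_empty (mem_avoiding_iff_eq_empty ⟨_, 0, hk, rfl⟩ ?_)
  rintro E ⟨i, -, rfl⟩ v hv
  rw [Finset.mem_coe, mem_window] at hv
  rw [Set.mem_preimage, mem_cyclicSegment]
  omega

end Cyclic

section Paths

variable {n m l k i : ℕ}

lemma mem_path (hmn : m ≤ n) (hi : i * l < n) {v : Fin n} :
    v ∈ path n m l i ↔ (i * l ≤ v ∧ v < i * l + m) ∨ v + n < i * l + m := by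
  have hv := v.isLt
  simp only [path, Finset.mem_filter, Finset.mem_univ, true_and]
  constructor
  · rintro ⟨j, hj, hvj⟩
    rcases lt_or_ge (i * l + j) n with h | h
    · rw [Nat.mod_eq_of_lt h] at hvj
      omega
    · rw [Nat.mod_eq_sub_mod h, Nat.mod_eq_of_lt (by omega)] at hvj
      omega
  · rintro (h | h)
    · exact ⟨v - i * l, by omega, by rw [Nat.add_sub_cancel' h.1, Nat.mod_eq_of_lt hv]⟩
    · refine ⟨v + n - i * l, by omega, ?_⟩
      rw [Nat.add_sub_cancel' (by omega), Nat.add_mod_right, Nat.mod_eq_of_lt hv]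

lemma card_path (hn : 0 < n) (hmn : m ≤ n) : (path n m l i).card = m := by
  have himage : path n m l i =
      (Finset.range m).image fun j => (⟨(i * l + j) % n, Nat.mod_lt _ hn⟩ : Fin n) := by
    ext v
    simp [path, Fin.ext_iff, eq_comm]
  rw [himage, Finset.card_image_of_injOn, Finset.card_range]
  intro a ha b hb hab
  rw [Finset.mem_coe, Finset.mem_range] at ha hb
  have h : a ≡ b [MOD n] := Nat.ModEq.add_left_cancel' (i * l) (Fin.ext_iff.1 hab)
  exact h.eq_of_lt_of_lt (by omega) (by omega)

lemma complementComplex_pathComplex (hn : 0 < n) (hmn : m ≤ n) (hln : l ∣ n) :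
    complementComplex (pathComplex n m l) =
      avoiding Finset.univ {E | ∃ i < n / l, E = path n m l i} := by
  have hsized : Set.Sized m {F | ∃ i < n / l, F = path n m l i} := by
    rintro _ ⟨i, -, rfl⟩
    exact card_path hn hmn
  rw [pathComplex, Nat.gcd_eq_left hln, complementComplex_lowerClosure hsized.isAntichain]
  congr 1
  ext E
  simp only [Set.mem_image, Set.mem_ofPred_eq]
  grind

/-- The index of the block `{jl, …, jl + l - 1}` of the cycle to which a vertex belongs. -/
abbrev blockIndex (l : ℕ) (v : Fin n) : ℕ := v / l

/-- The last vertices of the blocks of length `l` into which the cycle is divided. -/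
def blockEnds (n l : ℕ) : Finset (Fin n) := {v | (v : ℕ) % l = l - 1}

lemma val_add_one_of_mem_blockEnds (hl : 0 < l) {v : Fin n} (hv : v ∈ blockEnds n l) :
    (v : ℕ) + 1 = ((v : ℕ) / l + 1) * l := by
  have hmod : (v : ℕ) % l = l - 1 := by simpa [blockEnds] using hv
  have hdiv := Nat.div_add_mod' (v : ℕ) l
  rw [Nat.succ_mul]
  omega

lemma injOn_blockEnds (hl : 0 < l) :
    Set.InjOn (blockIndex l) (blockEnds n l : Set (Fin n)) := by
  intro v hv w hw h
  have hvw := (val_add_one_of_mem_blockEnds hl hv).trans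
    ((congrArg (fun j => (j + 1) * l) h).trans (val_add_one_of_mem_blockEnds hl hw).symm)
  exact Fin.ext (Nat.succ.inj hvw)

lemma exists_mem_blockEnds (hl : 0 < l) {j : ℕ} (hj : j < k) :
    ∃ v ∈ blockEnds (k * l) l, (v : ℕ) / l = j := by
  have h := Nat.mul_le_mul_right l (Nat.succ_le_of_lt hj)
  rw [Nat.succ_mul] at h
  refine ⟨⟨j * l + (l - 1), by omega⟩, ?_, ?_⟩
  · simp only [blockEnds, Finset.mem_filter, Finset.mem_univ, true_and]
    rw [Nat.mul_add_mod', Nat.mod_eq_of_lt (by omega)]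
  · change (j * l + (l - 1)) / l = j
    rw [Nat.mul_comm, Nat.mul_add_div hl, Nat.div_eq_of_lt (by omega), add_zero]

lemma mem_path_iff_of_mem_blockEnds (hl : 0 < l) (hmn : m ≤ k * l) (hi : i < k)
    {v : Fin (k * l)} (hv : v ∈ blockEnds (k * l) l) :
    v ∈ path (k * l) m l i ↔ (v : ℕ) / l ∈ cyclicSegment (m / l) k i := by
  have hval := val_add_one_of_mem_blockEnds hl hv
  have hstart : i * l ≤ v ↔ i ≤ (v : ℕ) / l := (Nat.le_div_iff_mul_le hl).symm
  have hlt : ∀ j, (v : ℕ) + j * l < i * l + m ↔ (v : ℕ) / l + j < i + m / l := by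
    intro j
    rw [← Nat.mul_add_div hl, mul_comm l i, ← Nat.succ_le_iff (n := _ / l),
      Nat.le_div_iff_mul_le hl, Nat.succ_mul, add_mul]
    rw [Nat.succ_mul] at hval
    omega
  have hend : (v : ℕ) < i * l + m ↔ (v : ℕ) / l < i + m / l := by simpa using hlt 0
  rw [mem_path hmn (Nat.mul_lt_mul_of_pos_right hi hl), mem_cyclicSegment, hstart, hend, hlt k,
    Nat.lt_sub_iff_add_lt]

lemma exists_mem_blockEnds_dominating (hl : 0 < l) (hmn : m ≤ k * l) (v : Fin (k * l)) :
    ∃ w ∈ blockEnds (k * l) l, ∀ i < k, w ∈ path (k * l) m l i → v ∈ path (k * l) m l i := by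
  have hvk : (v : ℕ) / l < k := Nat.div_lt_of_lt_mul (v.isLt.trans_eq (mul_comm k l))
  obtain ⟨w, hw, hwv⟩ := exists_mem_blockEnds hl hvk
  refine ⟨w, hw, fun i hi => ?_⟩
  have hvw : (v : ℕ) ≤ w := by
    have hv : (v : ℕ) < ((v : ℕ) / l + 1) * l :=
      (Nat.div_lt_iff_lt_mul hl).1 (Nat.lt_succ_self _)
    rw [← hwv, ← val_add_one_of_mem_blockEnds hl hw] at hv
    exact Nat.le_of_lt_succ hv
  have hstart : i * l ≤ v ↔ i * l ≤ w := by
    rw [← Nat.le_div_iff_mul_le hl, ← Nat.le_div_iff_mul_le hl, hwv]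
  rw [mem_path hmn (Nat.mul_lt_mul_of_pos_right hi hl),
    mem_path hmn (Nat.mul_lt_mul_of_pos_right hi hl), hstart]
  omega

lemma avoiding_blockEnds_paths (hl : 0 < l) (hmn : m ≤ k * l) :
    avoiding (blockEnds (k * l) l) {E | ∃ i < k, E = path (k * l) m l i} =
      cyclicComplex (blockIndex l) (blockEnds (k * l) l) (m / l) k k := by
  have hwindow : window (blockIndex l) (blockEnds (k * l) l) 0 k =
      blockEnds (k * l) l :=
    Finset.filter_true_of_mem fun v _ =>
      ⟨Nat.zero_le _, Nat.div_lt_of_lt_mul (v.isLt.trans_eq (mul_comm k l))⟩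
  rw [cyclicComplex, hwindow]
  refine avoiding_congr ?_ ?_ <;> rintro _ ⟨i, hi, rfl⟩
  · exact ⟨_, ⟨i, hi, rfl⟩, fun v hv => (mem_path_iff_of_mem_blockEnds hl hmn hi hv).2⟩
  · exact ⟨_, ⟨i, hi, rfl⟩, fun v hv => (mem_path_iff_of_mem_blockEnds hl hmn hi hv).1⟩

variable {K : Type*} [Field K]

lemma isConcentrated_complementComplex_pathComplex (hl : 0 < l) (hk : 0 < k) (hmn : m ≤ k * l)
    {e : ℤ} {r : ℕ}
    (h : IsConcentrated K
      (cyclicComplex (blockIndex l) (blockEnds (k * l) l) (m / l) k k) e r) :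
    IsConcentrated K (complementComplex (pathComplex (k * l) m l)) e r := by
  rw [complementComplex_pathComplex (Nat.mul_pos hk hl) hmn (Nat.dvd_mul_left l k),
    Nat.mul_div_cancel k hl]
  rw [← avoiding_blockEnds_paths hl hmn] at h
  refine isConcentrated_avoiding_of_dominated (Finset.subset_univ _) (fun v _ _ => ?_) h
  obtain ⟨w, hw, hwv⟩ := exists_mem_blockEnds_dominating hl hmn v
  refine ⟨w, hw, ?_⟩
  rintro _ ⟨i, hi, rfl⟩
  exact hwv i hi

theorem isConcentrated_complementComplex_pathComplex_of_eq_mul (hl : 0 < l) (hk : 0 < k)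
    (hmn : m ≤ k * l) {p : ℕ} (hkp : k = p * (m / l + 1)) :
    IsConcentrated K (complementComplex (pathComplex (k * l) m l)) (2 * p - 2) (m / l) := by
  refine isConcentrated_complementComplex_pathComplex hl hk hmn ?_
  cases p with
  | zero => omega
  | succ p =>
    convert isConcentrated_cyclicComplex_of_eq_mul (injOn_blockEnds hl)
      (fun _ hj => exists_mem_blockEnds hl hj) hkp using 1
    push_cast
    ring

theorem isConcentrated_complementComplex_pathComplex_of_eq_mul_add (hl : 0 < l)
    (hmn : m ≤ k * l) {p d : ℕ} (hd0 : d ≠ 0) (hd : d ≤ m / l) (hkp : k = p * (m / l + 1) + d) :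
    IsConcentrated K (complementComplex (pathComplex (k * l) m l)) (2 * p - 1) 1 := by
  refine isConcentrated_complementComplex_pathComplex hl (by omega) hmn ?_
  cases p with
  | zero => simpa using isConcentrated_cyclicComplex_of_le (by omega) (by omega)
  | succ p =>
    convert isConcentrated_cyclicComplex_of_eq_mul_add (injOn_blockEnds hl)
      (fun _ hj => exists_mem_blockEnds hl hj) hd0 hd hkp using 1
    push_cast
    ring

end Paths

end CyclePaths

open SimplicialHomology CyclePaths in
theorem theorem4p7_general (K : Type*) [Field K] (l m n t k p d : ℕ)
    (hn : 0 < n) (hmn : m ≤ n) (hln : l ∣ n) (ht : t = m / l) (hk : k = n / l)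
    (hkp : k = p * (t + 1) + d) (hd : d ≤ t) (i : ℤ) :
    (d = 0 ∧ i = 2 * (p : ℤ) - 2 ∧ 0 < p →
      Nonempty (ReducedHomology K (complementComplex (pathComplex n m l)) i ≃ₗ[K] (Fin t → K))) ∧
    (d ≠ 0 ∧ i = 2 * (p : ℤ) - 1 →
      Nonempty (ReducedHomology K (complementComplex (pathComplex n m l)) i ≃ₗ[K] K)) ∧
    (¬ (d = 0 ∧ i = 2 * (p : ℤ) - 2 ∧ 0 < p) → ¬ (d ≠ 0 ∧ i = 2 * (p : ℤ) - 1) →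
      Subsingleton (ReducedHomology K (complementComplex (pathComplex n m l)) i)) := by
  obtain ⟨q, rfl⟩ := exists_eq_mul_left_of_dvd hln
  have hl : 0 < l := Nat.pos_of_mul_pos_left hn
  obtain rfl : k = q := by rw [hk, Nat.mul_div_cancel q hl]
  have hk0 : 0 < k := Nat.pos_of_mul_pos_right hn
  subst ht
  by_cases hd0 : d = 0
  · subst hd0
    have h := isConcentrated_complementComplex_pathComplex_of_eq_mul (K := K) hl hk0 hmn hkp
    have hp : 0 < p := Nat.pos_of_ne_zero fun hp => by simp [hp, hk0.ne'] at hkp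
    refine ⟨?_, fun hi => absurd rfl hi.1, fun hi _ => h.1 i fun hi' => hi ⟨rfl, hi', hp⟩⟩
    rintro ⟨-, rfl, -⟩
    exact h.nonempty_linearEquiv
  · have h := isConcentrated_complementComplex_pathComplex_of_eq_mul_add (K := K) hl hmn hd0 hd hkp
    refine ⟨fun hi => absurd hi.1 hd0, ?_, fun _ hi => h.1 i fun hi' => hi ⟨hd0, hi'⟩⟩
    rintro ⟨-, rfl⟩
    exact h.nonempty_linearEquiv.map (·.trans (LinearEquiv.funUnique (Fin 1) K K))

open SimplicialHomology CyclePaths in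
theorem theorem4p7 (K : Type*) [Field K] (l m n s t k p d : ℕ)
    (hl : 0 < l) (hm : 2 ≤ m) (hmn : m ≤ n) (hln : l ∣ n) (hlmin : l ≤ min (m - 1) (n / 2))
    (hms : m ≡ s [MOD l]) (hs : s < l) (ht : t = (m - s) / l) (ht2 : 2 ≤ t) (hk : k = n / l)
    (hkp : k = p * (t + 1) + d) (hd : d ≤ t) (i : ℤ) :
    (d = 0 ∧ i = 2 * (p : ℤ) - 2 ∧ 0 < p →
      Nonempty (ReducedHomology K (complementComplex (pathComplex n m l)) i ≃ₗ[K] (Fin t → K))) ∧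
    (d ≠ 0 ∧ i = 2 * (p : ℤ) - 1 →
      Nonempty (ReducedHomology K (complementComplex (pathComplex n m l)) i ≃ₗ[K] K)) ∧
    (¬ (d = 0 ∧ i = 2 * (p : ℤ) - 2 ∧ 0 < p) → ¬ (d ≠ 0 ∧ i = 2 * (p : ℤ) - 1) →
      Subsingleton (ReducedHomology K (complementComplex (pathComplex n m l)) i)) :=
  theorem4p7_general K l m n t k p d (by omega) hmn hln
    (by rw [ht, ← Nat.mod_eq_of_lt hs, ← hms]; exact Nat.div_eq_sub_mod_div.symm) hk hkp hd i
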